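/- Let $p\in[1,\infty)$ with $p\neq 2$, let $\mu$ be an arbitrary measure (not assumed finite, $\sigma$-finite or localizable) and let $L_p(\mu)$ be the real $L_p$-space of $\mu$. (1) Every linear isometry $T:L_p(\mu)\to L_p(\mu)$ (surjective or not) different from the identity $\mathbf I$ satisfies $\|T-\mathbf I\|>\sqrt 2$ in the operator norm. (2) Consequently the group $\operatorname{Iso}(L_p(\mu))$ of linear surjective isometries of $L_p(\mu)$ is discrete in the operator-norm topology. (3) If $\mu$ has no atoms (that is, every measurable set of positive measure is the disjoint union of two measurable sets of positive measure), then for every linear isometry $T\neq\mathbf I$ of $L_p(\mu)$ into itself there is an infinite-dimensional closed subspace $E\subseteq L_p(\mu)$ such that the restriction of $T-\mathbf I$ to $E$ is an isomorphism (a linear homeomorphism) of $E$ onto $(T-\mathbf I)(E)$. -/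

import Mathlib

open MeasureTheory
open scoped ENNReal

/-- An atom of `μ`: a measurable set of positive measure which is not the disjoint union of two
measurable sets of positive measure. (For singletons only, Mathlib has `MeasureTheory.NoAtoms`;
on a general measurable space that is a different notion.) -/
def IsMeasureAtom {Ω : Type*} [MeasurableSpace Ω] (μ : Measure Ω) (A : Set Ω) : Prop :=
  MeasurableSet A ∧ μ A ≠ 0 ∧
    ∀ B : Set Ω, B ⊆ A → MeasurableSet B → μ B = 0 ∨ μ (A \ B) = 0

/-- The measure `μ` has no atoms. -/
def HasNoAtoms {Ω : Type*} [MeasurableSpace Ω] (μ : Measure Ω) : Prop :=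
  ∀ A : Set Ω, ¬ IsMeasureAtom μ A

/-- The linear surjective isometries of `X`, as a set of bounded operators. As a subtype it carries
the topology of the operator norm. -/
def isoSet (X : Type*) [NormedAddCommGroup X] [NormedSpace ℝ X] : Set (X →L[ℝ] X) :=
  Set.range fun T : X ≃ₗᵢ[ℝ] X => (T.toContinuousLinearEquiv : X →L[ℝ] X)

/-- The operator `S` restricts to a linear homeomorphism from the subspace `E` onto `S(E)`. -/
def IsIsomorphismOn {X Y : Type*} [NormedAddCommGroup X] [NormedSpace ℝ X]
    [NormedAddCommGroup Y] [NormedSpace ℝ Y] (S : X →L[ℝ] Y) (E : Submodule ℝ X) : Prop :=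
  ∃ e : E ≃L[ℝ] E.map (S : X →ₗ[ℝ] Y), ∀ x : E, (e x : Y) = S (x : X)

/-! For `p ≠ 2`, two functions give equality in Clarkson's inequality exactly when their supports
are a.e. disjoint. Equality involves only norms, so isometries preserve disjointness
(`AEDisjointSupport.map`).

This yields a dichotomy (`exists_disjoint_map_or_exists_map_eq_neg`). Either some `g ≠ 0` is
disjoint from `T g`, or `T` commutes with all indicators. In the second case `|T f| = |f|` a.e., so
`T ≠ I` must flip the sign of some `h ≠ 0` and of all its restrictions.

A flipped vector is moved by twice its norm. In the disjoint case `g` is stretched by `2 ^ (1/p)`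
and `T g - g` by at least `2 ^ (1 - 1/p)`; one of these exceeds `√2`. Restrictions of `g` or `h` to
disjoint sets span the subspace needed when there are no atoms. -/

section PowerInequalities

/-! ### Scalar power inequalities. -/

theorem add_rpow_lt_rpow_add_of_one_lt {s t r : ℝ} (hs : 0 < s) (ht : 0 < t) (hr : 1 < r) :
    s ^ r + t ^ r < (s + t) ^ r := by
  have split : ∀ x : ℝ, 0 < x → x ^ r = x * x ^ (r - 1) := fun x hx => by
    rw [Real.rpow_sub_one hx.ne', mul_div_cancel₀ _ hx.ne']
  have h1 : s ^ (r - 1) < (s + t) ^ (r - 1) :=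
    Real.rpow_lt_rpow hs.le (by linarith) (by linarith)
  have h2 : t ^ (r - 1) < (s + t) ^ (r - 1) :=
    Real.rpow_lt_rpow ht.le (by linarith) (by linarith)
  rw [split s hs, split t ht, split _ (add_pos hs ht), add_mul]
  exact add_lt_add (mul_lt_mul_of_pos_left h1 hs) (mul_lt_mul_of_pos_left h2 ht)

theorem rpow_add_lt_add_rpow_of_lt_one {s t r : ℝ} (hs : 0 < s) (ht : 0 < t) (hr : r < 1) :
    (s + t) ^ r < s ^ r + t ^ r := by
  have split : ∀ x : ℝ, 0 < x → x ^ r = x * x ^ (r - 1) := fun x hx => by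
    rw [Real.rpow_sub_one hx.ne', mul_div_cancel₀ _ hx.ne']
  have h1 : (s + t) ^ (r - 1) < s ^ (r - 1) :=
    Real.rpow_lt_rpow_of_neg hs (by linarith) (by linarith)
  have h2 : (s + t) ^ (r - 1) < t ^ (r - 1) :=
    Real.rpow_lt_rpow_of_neg ht (by linarith) (by linarith)
  rw [split s hs, split t ht, split _ (add_pos hs ht), add_mul]
  exact add_lt_add (mul_lt_mul_of_pos_left h1 hs) (mul_lt_mul_of_pos_left h2 ht)

theorem abs_rpow_eq_sq_rpow (x q : ℝ) : |x| ^ q = (x ^ 2) ^ (q / 2) := by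
  rw [← sq_abs, ← Real.rpow_natCast, ← Real.rpow_mul (abs_nonneg x)]
  congr 1
  push_cast
  ring

/-- The strict Clarkson inequality for real numbers and exponents above `2`. -/
theorem clarkson_lt_of_two_lt {q a b : ℝ} (hq : 2 < q) (ha : a ≠ 0) (hb : b ≠ 0) :
    2 * (|a| ^ q + |b| ^ q) < |a + b| ^ q + |a - b| ^ q := by
  simp only [abs_rpow_eq_sq_rpow]
  -- Strict superadditivity compares `a²` and `b²` with `a² + b²`, which is the mean of `(a + b)²`
  -- and `(a - b)²`; convexity does the rest.
  have h1 := add_rpow_lt_rpow_add_of_one_lt (sq_pos_of_ne_zero ha) (sq_pos_of_ne_zero hb)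
    (show 1 < q / 2 by linarith)
  have h2 := (convexOn_rpow (show 1 ≤ q / 2 by linarith)).2
    (Set.mem_Ici.2 (sq_nonneg (a + b))) (Set.mem_Ici.2 (sq_nonneg (a - b)))
    (show (0 : ℝ) ≤ 1 / 2 by norm_num) (show (0 : ℝ) ≤ 1 / 2 by norm_num) (by norm_num)
  simp only [smul_eq_mul] at h2
  rw [show 1 / 2 * (a + b) ^ 2 + 1 / 2 * (a - b) ^ 2 = a ^ 2 + b ^ 2 by ring] at h2
  linarith

/-- The strict Clarkson inequality for real numbers and exponents below `2`. -/
theorem clarkson_gt_of_lt_two {q a b : ℝ} (hq0 : 0 ≤ q) (hq : q < 2) (ha : a ≠ 0) (hb : b ≠ 0) :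
    |a + b| ^ q + |a - b| ^ q < 2 * (|a| ^ q + |b| ^ q) := by
  simp only [abs_rpow_eq_sq_rpow]
  have h1 := rpow_add_lt_add_rpow_of_lt_one (sq_pos_of_ne_zero ha) (sq_pos_of_ne_zero hb)
    (show q / 2 < 1 by linarith)
  have h2 := (Real.concaveOn_rpow (show 0 ≤ q / 2 by linarith) (show q / 2 ≤ 1 by linarith)).2
    (Set.mem_Ici.2 (sq_nonneg (a + b))) (Set.mem_Ici.2 (sq_nonneg (a - b)))
    (show (0 : ℝ) ≤ 1 / 2 by norm_num) (show (0 : ℝ) ≤ 1 / 2 by norm_num) (by norm_num)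
  simp only [smul_eq_mul] at h2
  rw [show 1 / 2 * (a + b) ^ 2 + 1 / 2 * (a - b) ^ 2 = a ^ 2 + b ^ 2 by ring] at h2
  linarith

theorem clarkson_eq_of_eq_zero_or {q a b : ℝ} (hq : q ≠ 0) (h : a = 0 ∨ b = 0) :
    |a + b| ^ q + |a - b| ^ q = 2 * (|a| ^ q + |b| ^ q) := by
  rcases h with rfl | rfl <;> simp [Real.zero_rpow hq] <;> ring

end PowerInequalities

namespace MeasureTheory.Lp

/-! ### Disjointness of supports. -/

variable {Ω : Type*} [MeasurableSpace Ω] {μ : Measure Ω} {p : ℝ≥0∞}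

/-- Two elements of `Lp` are disjoint if at almost every point one of them vanishes. -/
def AEDisjointSupport (f g : Lp ℝ p μ) : Prop := ∀ᵐ x ∂μ, f x = 0 ∨ g x = 0

theorem AEDisjointSupport.symm {f g : Lp ℝ p μ} (h : AEDisjointSupport f g) :
    AEDisjointSupport g f := by
  filter_upwards [h] with x hx using hx.symm

theorem norm_rpow_eq_integral (hp : p ≠ 0) (hp_top : p ≠ ∞) (f : Lp ℝ p μ) :
    ‖f‖ ^ p.toReal = ∫ x, |f x| ^ p.toReal ∂μ := by
  rw [Lp.norm_def, (Lp.memLp f).eLpNorm_eq_integral_rpow_norm hp hp_top,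
    ENNReal.toReal_ofReal (by positivity), ← Real.rpow_mul (by positivity),
    inv_mul_cancel₀ (ENNReal.toReal_pos hp hp_top).ne', Real.rpow_one]
  simp only [Real.norm_eq_abs]

theorem integrable_abs_rpow (hp : p ≠ 0) (hp_top : p ≠ ∞) (f : Lp ℝ p μ) :
    Integrable (fun x => |f x| ^ p.toReal) μ :=
  (Lp.memLp f).integrable_norm_rpow hp hp_top

theorem AEDisjointSupport.norm_add_rpow (hp : p ≠ 0) (hp_top : p ≠ ∞) {f g : Lp ℝ p μ}
    (h : AEDisjointSupport f g) :
    ‖f + g‖ ^ p.toReal = ‖f‖ ^ p.toReal + ‖g‖ ^ p.toReal := by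
  simp only [norm_rpow_eq_integral hp hp_top]
  rw [← integral_add (integrable_abs_rpow hp hp_top f) (integrable_abs_rpow hp hp_top g)]
  refine integral_congr_ae ?_
  have hq := (ENNReal.toReal_pos hp hp_top).ne'
  filter_upwards [h, Lp.coeFn_add f g] with x hx hfg
  rw [hfg, Pi.add_apply]
  rcases hx with hx | hx <;> simp [hx, Real.zero_rpow hq]

theorem AEDisjointSupport.neg_right {f g : Lp ℝ p μ} (h : AEDisjointSupport f g) :
    AEDisjointSupport f (-g) := by
  filter_upwards [h, Lp.coeFn_neg g] with x hx hg
  rwa [hg, Pi.neg_apply, neg_eq_zero]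

theorem AEDisjointSupport.norm_sub_rpow (hp : p ≠ 0) (hp_top : p ≠ ∞) {f g : Lp ℝ p μ}
    (h : AEDisjointSupport f g) :
    ‖f - g‖ ^ p.toReal = ‖f‖ ^ p.toReal + ‖g‖ ^ p.toReal := by
  rw [sub_eq_add_neg, h.neg_right.norm_add_rpow hp hp_top, norm_neg]

/-- The equality case of Clarkson's inequality. -/
theorem aeDisjointSupport_of_clarkson_eq (hp : p ≠ 0) (hp_top : p ≠ ∞) (hp_two : p ≠ 2)
    {f g : Lp ℝ p μ}
    (h : ‖f + g‖ ^ p.toReal + ‖f - g‖ ^ p.toReal = 2 * (‖f‖ ^ p.toReal + ‖g‖ ^ p.toReal)) :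
    AEDisjointSupport f g := by
  have hq := ENNReal.toReal_pos hp hp_top
  have hq2 : p.toReal ≠ 2 := fun h => hp_two <| by
    rw [← ENNReal.ofReal_toReal hp_top, h]; simp
  have int := integrable_abs_rpow (μ := μ) hp hp_top
  simp only [norm_rpow_eq_integral hp hp_top] at h
  rw [← integral_add (int _) (int _), ← integral_add (int _) (int _), ← integral_const_mul] at h
  have hL := (int (f + g)).add (int (f - g))
  have hR := ((int f).add (int g)).const_mul 2
  -- The integrands are ordered pointwise, in a direction depending on the side of `2` on which `p`
  -- lies, so equal integrals force a.e. equality.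
  have key : ∀ᵐ x ∂μ, |(f + g : Lp ℝ p μ) x| ^ p.toReal + |(f - g : Lp ℝ p μ) x| ^ p.toReal
      = 2 * (|f x| ^ p.toReal + |g x| ^ p.toReal) := by
    rcases lt_or_gt_of_ne hq2 with hlt | hgt
    · refine (integral_eq_iff_of_ae_le hL hR ?_).1 h
      filter_upwards [Lp.coeFn_add f g, Lp.coeFn_sub f g] with x h1 h2
      simp only [Pi.add_apply, h1, h2, Pi.sub_apply]
      by_cases hx : f x = 0 ∨ g x = 0
      · exact (clarkson_eq_of_eq_zero_or hq.ne' hx).le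
      · rw [not_or] at hx
        exact (clarkson_gt_of_lt_two hq.le hlt hx.1 hx.2).le
    · refine ((integral_eq_iff_of_ae_le hR hL ?_).1 h.symm).symm
      filter_upwards [Lp.coeFn_add f g, Lp.coeFn_sub f g] with x h1 h2
      simp only [Pi.add_apply, h1, h2, Pi.sub_apply]
      by_cases hx : f x = 0 ∨ g x = 0
      · exact (clarkson_eq_of_eq_zero_or hq.ne' hx).ge
      · rw [not_or] at hx
        exact (clarkson_lt_of_two_lt hgt hx.1 hx.2).le
  filter_upwards [key, Lp.coeFn_add f g, Lp.coeFn_sub f g] with x hx h1 h2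
  rw [h1, h2, Pi.add_apply, Pi.sub_apply] at hx
  by_contra hne
  rw [not_or] at hne
  rcases lt_or_gt_of_ne hq2 with hlt | hgt
  · exact (clarkson_gt_of_lt_two hq.le hlt hne.1 hne.2).ne hx
  · exact (clarkson_lt_of_two_lt hgt hne.1 hne.2).ne' hx

/-- Lamperti: for `p ≠ 2` a linear isometry of `Lp` preserves disjointness of supports. -/
theorem AEDisjointSupport.map [Fact (1 ≤ p)] (hp_top : p ≠ ∞) (hp_two : p ≠ 2)
    (T : Lp ℝ p μ →ₗᵢ[ℝ] Lp ℝ p μ) {f g : Lp ℝ p μ} (h : AEDisjointSupport f g) :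
    AEDisjointSupport (T f) (T g) := by
  have hp : p ≠ 0 := (zero_lt_one.trans_le Fact.out).ne'
  refine aeDisjointSupport_of_clarkson_eq hp hp_top hp_two ?_
  rw [← map_add, ← map_sub]
  simp only [T.norm_map]
  rw [h.norm_add_rpow hp hp_top, h.norm_sub_rpow hp hp_top]
  ring

/-! ### Multiplication by indicator functions. -/

theorem measurableSet_support (f : Lp ℝ p μ) : MeasurableSet {x | f x ≠ 0} :=
  (Lp.stronglyMeasurable f).measurable (measurableSet_singleton 0).compl

/-- The product of an element of `Lp` with the indicator function of a measurable set. -/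
noncomputable def indicatorLp (s : Set Ω) (hs : MeasurableSet s) (f : Lp ℝ p μ) : Lp ℝ p μ :=
  MemLp.toLp (s.indicator f) ((Lp.memLp f).indicator hs)

theorem coeFn_indicatorLp (s : Set Ω) (hs : MeasurableSet s) (f : Lp ℝ p μ) :
    indicatorLp s hs f =ᵐ[μ] s.indicator f := by
  unfold indicatorLp
  exact MemLp.coeFn_toLp _

theorem norm_indicatorLp_le (s : Set Ω) (hs : MeasurableSet s) (f : Lp ℝ p μ) :
    ‖indicatorLp s hs f‖ ≤ ‖f‖ := by
  refine Lp.norm_le_norm_of_ae_le ?_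
  filter_upwards [coeFn_indicatorLp s hs f] with x hx
  rw [hx]
  exact norm_indicator_le_norm_self _ _

theorem indicatorLp_add (s : Set Ω) (hs : MeasurableSet s) (f g : Lp ℝ p μ) :
    indicatorLp s hs (f + g) = indicatorLp s hs f + indicatorLp s hs g := by
  ext1
  filter_upwards [coeFn_indicatorLp s hs (f + g), coeFn_indicatorLp s hs f,
    coeFn_indicatorLp s hs g, Lp.coeFn_add f g,
    Lp.coeFn_add (indicatorLp s hs f) (indicatorLp s hs g)] with x h1 h2 h3 h4 h5
  rw [h5, Pi.add_apply, h1, h2, h3]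
  by_cases hx : x ∈ s
  · simp only [Set.indicator_of_mem hx, h4, Pi.add_apply]
  · simp only [Set.indicator_of_notMem hx, add_zero]

theorem indicatorLp_smul (s : Set Ω) (hs : MeasurableSet s) (c : ℝ) (f : Lp ℝ p μ) :
    indicatorLp s hs (c • f) = c • indicatorLp s hs f := by
  ext1
  filter_upwards [coeFn_indicatorLp s hs (c • f), coeFn_indicatorLp s hs f,
    Lp.coeFn_smul c f, Lp.coeFn_smul c (indicatorLp s hs f)] with x h1 h2 h3 h4
  rw [h4, Pi.smul_apply, h1, h2]
  by_cases hx : x ∈ s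
  · simp only [Set.indicator_of_mem hx, h3, Pi.smul_apply]
  · simp only [Set.indicator_of_notMem hx, smul_zero]

variable [Fact (1 ≤ p)]

/-- Multiplication by the indicator function of a measurable set, as an operator on `Lp`. -/
noncomputable def indicatorCLM (s : Set Ω) (hs : MeasurableSet s) : Lp ℝ p μ →L[ℝ] Lp ℝ p μ :=
  LinearMap.mkContinuous
    { toFun := indicatorLp s hs
      map_add' := indicatorLp_add s hs
      map_smul' := indicatorLp_smul s hs }
    1 fun f => (norm_indicatorLp_le s hs f).trans_eq (one_mul _).symm

theorem coeFn_indicatorCLM (s : Set Ω) (hs : MeasurableSet s) (f : Lp ℝ p μ) :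
    indicatorCLM s hs f =ᵐ[μ] s.indicator f :=
  coeFn_indicatorLp s hs f

theorem norm_indicatorCLM_le (s : Set Ω) (hs : MeasurableSet s) (f : Lp ℝ p μ) :
    ‖indicatorCLM s hs f‖ ≤ ‖f‖ :=
  norm_indicatorLp_le s hs f

theorem indicatorCLM_eq_self_iff {s : Set Ω} {hs : MeasurableSet s} {f : Lp ℝ p μ} :
    indicatorCLM s hs f = f ↔ ∀ᵐ x ∂μ, x ∉ s → f x = 0 := by
  rw [Lp.ext_iff]
  constructor <;> intro h <;> filter_upwards [h, coeFn_indicatorCLM s hs f] with x h1 h2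
  · intro hx
    rw [← h1, h2, Set.indicator_of_notMem hx]
  · by_cases hx : x ∈ s
    · simp [h2, hx]
    · simp [h2, hx, h1 hx]

theorem indicatorCLM_eq_zero_iff {s : Set Ω} {hs : MeasurableSet s} {f : Lp ℝ p μ} :
    indicatorCLM s hs f = 0 ↔ ∀ᵐ x ∂μ, x ∈ s → f x = 0 := by
  rw [Lp.eq_zero_iff_ae_eq_zero]
  constructor <;> intro h <;> filter_upwards [h, coeFn_indicatorCLM s hs f] with x h1 h2
  · intro hx
    rwa [h2, Set.indicator_of_mem hx] at h1
  · by_cases hx : x ∈ s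
    · simp [h2, hx, h1 hx]
    · simp [h2, hx]

theorem indicatorCLM_add_compl (s : Set Ω) (hs : MeasurableSet s) (f : Lp ℝ p μ) :
    indicatorCLM s hs f + indicatorCLM sᶜ hs.compl f = f := by
  ext1
  filter_upwards [Lp.coeFn_add (indicatorCLM s hs f) (indicatorCLM sᶜ hs.compl f),
    coeFn_indicatorCLM s hs f, coeFn_indicatorCLM sᶜ hs.compl f] with x h1 h2 h3
  rw [h1, Pi.add_apply, h2, h3]
  by_cases hx : x ∈ s <;> simp [hx]

theorem aeDisjointSupport_indicatorCLM {s t : Set Ω} (hs : MeasurableSet s)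
    (ht : MeasurableSet t) (hst : Disjoint s t) (f g : Lp ℝ p μ) :
    AEDisjointSupport (indicatorCLM s hs f) (indicatorCLM t ht g) := by
  filter_upwards [coeFn_indicatorCLM s hs f, coeFn_indicatorCLM t ht g] with x h1 h2
  by_cases hx : x ∈ s
  · exact Or.inr (by rw [h2, Set.indicator_of_notMem (Set.disjoint_left.1 hst hx)])
  · exact Or.inl (by rw [h1, Set.indicator_of_notMem hx])

end MeasureTheory.Lp

namespace MeasureTheory.Lp

/-! ### The dichotomy and the bound `√2`. -/

variable {Ω : Type*} [MeasurableSpace Ω] {μ : Measure Ω} {p : ℝ≥0∞} [Fact (1 ≤ p)]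

/-- An isometry which moves no nonzero function to a function disjoint from it commutes with
multiplication by indicator functions. -/
theorem map_indicatorCLM_of_forall_not_disjoint (hp_top : p ≠ ∞) (hp_two : p ≠ 2)
    (T : Lp ℝ p μ →ₗᵢ[ℝ] Lp ℝ p μ)
    (hT : ∀ g : Lp ℝ p μ, AEDisjointSupport g (T g) → g = 0)
    (s : Set Ω) (hs : MeasurableSet s) (f : Lp ℝ p μ) :
    T (indicatorCLM s hs f) = indicatorCLM s hs (T f) := by
  -- Let `g` be the part of `T f` off the support of `f`. Then `g` is disjoint from `f`, so `T g` is
  -- disjoint from `T f` and hence from `g`; thus `g = 0`.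
  have support : ∀ f : Lp ℝ p μ, ∀ᵐ x ∂μ, f x = 0 → T f x = 0 := by
    intro f
    have hD : MeasurableSet {x | f x ≠ 0}ᶜ := (measurableSet_support f).compl
    set g := indicatorCLM _ hD (T f) with hg
    have hgf : AEDisjointSupport g f := by
      filter_upwards [coeFn_indicatorCLM _ hD (T f)] with x hx
      by_cases h : f x = 0
      · exact Or.inr h
      · left
        rw [hg, hx, Set.indicator_of_notMem (by simpa using h)]
    have hTgg : AEDisjointSupport g (T g) := by
      filter_upwards [hgf.map hp_top hp_two T, coeFn_indicatorCLM _ hD (T f)] with x hx hxg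
      refine hx.symm.imp_left fun h => ?_
      rw [hg, hxg, Set.indicator_apply_eq_zero]
      exact fun _ => h
    filter_upwards [indicatorCLM_eq_zero_iff.1 (hT g hTgg)] with x hx h
    exact hx (by simpa using h)
  have hadd : T f = T (indicatorCLM s hs f) + T (indicatorCLM sᶜ hs.compl f) := by
    rw [← map_add, indicatorCLM_add_compl]
  have h1 : indicatorCLM s hs (T (indicatorCLM s hs f)) = T (indicatorCLM s hs f) := by
    rw [indicatorCLM_eq_self_iff]
    filter_upwards [support (indicatorCLM s hs f), coeFn_indicatorCLM s hs f] with x h1 h2 hx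
    exact h1 (by rw [h2, Set.indicator_of_notMem hx])
  have h2 : indicatorCLM s hs (T (indicatorCLM sᶜ hs.compl f)) = 0 := by
    rw [indicatorCLM_eq_zero_iff]
    filter_upwards [support (indicatorCLM sᶜ hs.compl f), coeFn_indicatorCLM sᶜ hs.compl f]
      with x h1 h2 hx
    exact h1 (by rw [h2, Set.indicator_of_notMem (by simpa using hx)])
  rw [hadd, map_add, h1, h2, add_zero]

/-- An isometry commuting with multiplication by indicator functions preserves absolute values. -/
theorem abs_map_ae_eq_of_comm_indicatorCLM (hp_top : p ≠ ∞) (T : Lp ℝ p μ →ₗᵢ[ℝ] Lp ℝ p μ)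
    (hT : ∀ (s : Set Ω) (hs : MeasurableSet s) (f : Lp ℝ p μ),
      T (indicatorCLM s hs f) = indicatorCLM s hs (T f)) (f : Lp ℝ p μ) :
    ∀ᵐ x ∂μ, |T f x| = |f x| := by
  have hp : p ≠ 0 := (zero_lt_one.trans_le Fact.out).ne'
  have hq := ENNReal.toReal_pos hp hp_top
  have hint : ∀ (s : Set Ω) (hs : MeasurableSet s) (u : Lp ℝ p μ),
      ∫ x in s, |u x| ^ p.toReal ∂μ = ‖indicatorCLM s hs u‖ ^ p.toReal := by
    intro s hs u
    rw [norm_rpow_eq_integral hp hp_top, ← integral_indicator hs]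
    refine integral_congr_ae ?_
    filter_upwards [coeFn_indicatorCLM s hs u] with x hx
    rw [hx]
    by_cases h : x ∈ s <;> simp [h, Real.zero_rpow hq.ne']
  -- Both functions are integrable, so equal integrals over sets determine them a.e. without
  -- σ-finiteness of `μ`.
  have hae := Integrable.ae_eq_of_forall_setIntegral_eq _ _ (integrable_abs_rpow hp hp_top (T f))
    (integrable_abs_rpow hp hp_top f) fun s hs _ => by
      rw [hint s hs, hint s hs, ← hT, T.norm_map]
  filter_upwards [hae] with x hx
  exact (Real.rpow_left_inj (abs_nonneg _) (abs_nonneg _) hq.ne').1 hx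

/-- Without a disjoint pair, `T f = ±f` pointwise a.e., and `h` is the part of a moved `f` where the
sign is negative. Allowing every `s` in the second alternative makes the `-1` eigenspace large. -/
theorem exists_disjoint_map_or_exists_map_eq_neg (hp_top : p ≠ ∞) (hp_two : p ≠ 2)
    (T : Lp ℝ p μ →ₗᵢ[ℝ] Lp ℝ p μ) (hT : T ≠ LinearIsometry.id) :
    (∃ g : Lp ℝ p μ, g ≠ 0 ∧ AEDisjointSupport g (T g)) ∨
    ∃ h : Lp ℝ p μ, h ≠ 0 ∧ ∀ (s : Set Ω) (hs : MeasurableSet s),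
      T (indicatorCLM s hs h) = -indicatorCLM s hs h := by
  by_cases hdisj : ∀ g : Lp ℝ p μ, AEDisjointSupport g (T g) → g = 0
  swap
  · left
    push Not at hdisj
    obtain ⟨g, h1, h2⟩ := hdisj
    exact ⟨g, h2, h1⟩
  right
  have hcomm := map_indicatorCLM_of_forall_not_disjoint hp_top hp_two T hdisj
  obtain ⟨f, hf⟩ : ∃ f, T f ≠ f := by
    by_contra hcon
    push Not at hcon
    exact hT (LinearIsometry.ext hcon)
  have habs := abs_map_ae_eq_of_comm_indicatorCLM hp_top T hcomm f
  have hC : MeasurableSet {x | T f x = -f x} :=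
    measurableSet_eq_fun (Lp.stronglyMeasurable _).measurable
      (Lp.stronglyMeasurable _).measurable.neg
  have hneg : T (indicatorCLM _ hC f) = -indicatorCLM _ hC f := by
    rw [hcomm]
    ext1
    filter_upwards [coeFn_indicatorCLM _ hC f, coeFn_indicatorCLM _ hC (T f),
      Lp.coeFn_neg (indicatorCLM _ hC f)] with x h1 h2 h3
    rw [h3, Pi.neg_apply, h1, h2]
    by_cases hx : x ∈ {x | T f x = -f x}
    · rw [Set.indicator_of_mem hx, Set.indicator_of_mem hx]
      exact hx
    · rw [Set.indicator_of_notMem hx, Set.indicator_of_notMem hx, neg_zero]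
  refine ⟨indicatorCLM _ hC f, fun h0 => hf ?_, fun s hs => by rw [hcomm, hneg, map_neg]⟩
  ext1
  filter_upwards [habs, indicatorCLM_eq_zero_iff.1 h0] with x h1 h2
  rcases abs_eq_abs.1 h1 with h | h
  · exact h
  · rw [h, h2 h, neg_zero]

theorem norm_sub_eq_of_disjoint (hp_top : p ≠ ∞)
    {g h : Lp ℝ p μ} (hgh : AEDisjointSupport g h) (hnorm : ‖h‖ = ‖g‖) :
    ‖h - g‖ = 2 ^ (1 / p.toReal) * ‖g‖ := by
  have hp : p ≠ 0 := (zero_lt_one.trans_le Fact.out).ne'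
  have hq := ENNReal.toReal_pos hp hp_top
  refine (Real.rpow_left_inj (norm_nonneg _) (by positivity) hq.ne').1 ?_
  rw [hgh.symm.norm_sub_rpow hp hp_top, hnorm, Real.mul_rpow (by positivity) (norm_nonneg _),
    ← Real.rpow_mul (by norm_num), one_div_mul_cancel hq.ne', Real.rpow_one]
  ring

/-- A nonidentity isometry of `Lp`, `p ≠ 2`, moves some vector by more than `√2` times its norm. -/
theorem exists_sqrt_two_mul_norm_lt (hp_top : p ≠ ∞) (hp_two : p ≠ 2)
    (T : Lp ℝ p μ →ₗᵢ[ℝ] Lp ℝ p μ) (hT : T ≠ LinearIsometry.id) :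
    ∃ f : Lp ℝ p μ, Real.sqrt 2 * ‖f‖ < ‖T f - f‖ := by
  have hp : p ≠ 0 := (zero_lt_one.trans_le Fact.out).ne'
  have hq := ENNReal.toReal_pos hp hp_top
  have hq2 : p.toReal ≠ 2 := fun h => hp_two <| by
    rw [← ENNReal.ofReal_toReal hp_top, h]; simp
  rcases exists_disjoint_map_or_exists_map_eq_neg hp_top hp_two T hT with
    ⟨g, hg, hdisj⟩ | ⟨h, hh, hneg⟩
  · have hgpos := norm_pos_iff.2 hg
    have hnorm := norm_sub_eq_of_disjoint hp_top hdisj (T.norm_map g)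
    rcases lt_or_gt_of_ne hq2 with hlt | hgt
    · refine ⟨g, ?_⟩
      rw [hnorm, Real.sqrt_eq_rpow]
      refine mul_lt_mul_of_pos_right ?_ hgpos
      exact Real.rpow_lt_rpow_of_exponent_lt one_lt_two (one_div_lt_one_div_of_lt hq hlt)
    -- Here `2 ^ (1/p) < √2`, so `g` itself is not enough. On the support of `T g` both `g` and `T
    -- (T g)` vanish, and `T (T g) - 2 T g + g` reduces to `-2 T g`.
    · refine ⟨T g - g, ?_⟩
      have hdisj' := hdisj.map hp_top hp_two T
      have hA := measurableSet_support (T g)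
      have hle : 2 * ‖g‖ ≤ ‖T (T g - g) - (T g - g)‖ := by
        have heq : indicatorCLM _ hA (T (T g - g) - (T g - g)) = (-2 : ℝ) • T g := by
          rw [map_sub T]
          ext1
          filter_upwards [coeFn_indicatorCLM _ hA (T (T g) - T g - (T g - g)),
            Lp.coeFn_sub (T (T g) - T g) (T g - g), Lp.coeFn_sub (T (T g)) (T g),
            Lp.coeFn_sub (T g) g, Lp.coeFn_smul (-2 : ℝ) (T g), hdisj, hdisj']
            with x h1 h2 h3 h4 h5 h6 h7
          rw [h1, h5, Pi.smul_apply, smul_eq_mul]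
          by_cases hx : T g x = 0
          · rw [Set.indicator_of_notMem (by simpa using hx), hx, mul_zero]
          · rw [Set.indicator_of_mem (by exact hx), h2, Pi.sub_apply, h3, h4, Pi.sub_apply,
              Pi.sub_apply, h6.resolve_right hx, h7.resolve_left hx]
            ring
        have := norm_indicatorCLM_le _ hA (T (T g - g) - (T g - g))
        rw [heq, norm_smul, T.norm_map] at this
        simpa using this
      refine lt_of_lt_of_le ?_ hle
      rw [hnorm, ← mul_assoc]
      refine mul_lt_mul_of_pos_right ?_ hgpos
      rw [Real.sqrt_eq_rpow, ← Real.rpow_add two_pos]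
      calc (2 : ℝ) ^ ((1 : ℝ) / 2 + 1 / p.toReal) < 2 ^ (1 : ℝ) := by
            refine Real.rpow_lt_rpow_of_exponent_lt one_lt_two ?_
            have := one_div_lt_one_div_of_lt two_pos hgt
            linarith
        _ = 2 := Real.rpow_one 2
  · refine ⟨h, ?_⟩
    have hu : indicatorCLM Set.univ MeasurableSet.univ h = h := by
      rw [indicatorCLM_eq_self_iff]
      simp
    have := hneg Set.univ MeasurableSet.univ
    rw [hu] at this
    rw [this, ← neg_add', norm_neg, ← two_smul ℝ h, norm_smul, Real.norm_two]
    refine mul_lt_mul_of_pos_right ?_ (norm_pos_iff.2 hh)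
    rw [Real.sqrt_lt' two_pos]
    norm_num

theorem sqrt_two_lt_norm_sub_id (hp_top : p ≠ ∞) (hp_two : p ≠ 2)
    (T : Lp ℝ p μ →ₗᵢ[ℝ] Lp ℝ p μ) (hT : T ≠ LinearIsometry.id) :
    Real.sqrt 2 < ‖T.toContinuousLinearMap - ContinuousLinearMap.id ℝ (Lp ℝ p μ)‖ := by
  obtain ⟨f, hf⟩ := exists_sqrt_two_mul_norm_lt hp_top hp_two T hT
  by_contra! hle
  refine hf.not_ge ?_
  exact (T.toContinuousLinearMap - ContinuousLinearMap.id ℝ (Lp ℝ p μ)).le_of_opNorm_le hle f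

end MeasureTheory.Lp

/-- If every nonidentity surjective isometry has distance at least `r > 0` from the identity, the
isometries form a discrete set of operators. -/
theorem discreteTopology_isoSet {X : Type*} [NormedAddCommGroup X] [NormedSpace ℝ X] {r : ℝ}
    (hr : 0 < r) (h : ∀ T : X ≃ₗᵢ[ℝ] X, T ≠ LinearIsometryEquiv.refl ℝ X →
      r ≤ ‖(T.toContinuousLinearEquiv : X →L[ℝ] X) - ContinuousLinearMap.id ℝ X‖) :
    DiscreteTopology (isoSet X) := by
  refine DiscreteTopology.of_forall_le_dist hr ?_
  rintro ⟨_, S, rfl⟩ ⟨_, T, rfl⟩ hne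
  -- Since `S T⁻¹ - I = (S - T) T⁻¹` and `T⁻¹` is isometric, the distance from `S` to `T` is at
  -- least that from `S T⁻¹` to `I`.
  have hST : T.symm.trans S ≠ LinearIsometryEquiv.refl ℝ X := by
    intro heq
    refine hne (Subtype.ext (ContinuousLinearMap.ext fun x => ?_))
    have := DFunLike.congr_fun heq (T x)
    simpa using this
  refine (h _ hST).trans ?_
  rw [Subtype.dist_eq, dist_eq_norm]
  refine ContinuousLinearMap.opNorm_le_bound _ (norm_nonneg _) fun x => ?_
  have := ((S.toContinuousLinearEquiv : X →L[ℝ] X) -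
    (T.toContinuousLinearEquiv : X →L[ℝ] X)).le_opNorm (T.symm x)
  simpa using this

theorem IsIsomorphismOn.of_norm_le {X Y : Type*} [NormedAddCommGroup X] [NormedSpace ℝ X]
    [NormedAddCommGroup Y] [NormedSpace ℝ Y] {S : X →L[ℝ] Y} {E : Submodule ℝ X}
    (h : ∀ x ∈ E, ‖x‖ ≤ ‖S x‖) : IsIsomorphismOn S E := by
  have hinj : Function.Injective ((S : X →ₗ[ℝ] Y).submoduleMap E) := by
    rw [injective_iff_map_eq_zero]
    intro x hx
    have hS : S (x : X) = 0 := congrArg Subtype.val hx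
    have := h x x.2
    rw [hS, norm_zero] at this
    exact Subtype.ext (norm_le_zero_iff.1 this)
  let e := LinearEquiv.ofBijective ((S : X →ₗ[ℝ] Y).submoduleMap E)
    ⟨hinj, LinearMap.submoduleMap_surjective _ _⟩
  refine ⟨e.toContinuousLinearEquivOfBounds ‖S‖ 1 (fun x => S.le_opNorm x) fun y => ?_,
    fun x => rfl⟩
  obtain ⟨x, rfl⟩ := e.surjective y
  rw [e.symm_apply_apply, one_mul]
  exact h x x.2

/-- Repeated splitting gives a decreasing sequence whose successive differences have positive
measure; these differences are the `C n`. -/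
theorem HasNoAtoms.exists_disjoint_seq {Ω : Type*} [MeasurableSpace Ω] {μ : Measure Ω}
    (hμ : HasNoAtoms μ) {A : Set Ω} (hA : MeasurableSet A) (hA0 : μ A ≠ 0) :
    ∃ C : ℕ → Set Ω, (∀ n, MeasurableSet (C n)) ∧ (∀ n, C n ⊆ A) ∧ (∀ n, μ (C n) ≠ 0) ∧
      Pairwise (Function.onFun Disjoint C) := by
  have split : ∀ B : {B : Set Ω // MeasurableSet B ∧ μ B ≠ 0},
      ∃ B' : {B : Set Ω // MeasurableSet B ∧ μ B ≠ 0}, B'.1 ⊆ B.1 ∧ μ (B.1 \ B'.1) ≠ 0 := by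
    rintro ⟨B, hB, hB0⟩
    have := hμ B
    simp only [IsMeasureAtom, not_and, not_forall, not_or] at this
    obtain ⟨B', h1, h2, h3, h4⟩ := this hB hB0
    exact ⟨⟨B', h2, h3⟩, h1, h4⟩
  choose next hsub hdiff using split
  let B : ℕ → {B : Set Ω // MeasurableSet B ∧ μ B ≠ 0} := fun n => next^[n] ⟨A, hA, hA0⟩
  have hsucc : ∀ n, B (n + 1) = next (B n) := fun n => Function.iterate_succ_apply' _ _ _
  have hanti : Antitone fun n => (B n).1 := antitone_nat_of_succ_le fun n => by
    rw [hsucc]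
    exact hsub _
  refine ⟨fun n => (B n).1 \ (B (n + 1)).1, fun n => (B n).2.1.diff (B (n + 1)).2.1,
    fun n => Set.sdiff_subset.trans (hanti (Nat.zero_le n)), fun n => ?_, ?_⟩
  · simp only [hsucc]
    exact hdiff _
  · rw [pairwise_disjoint_on]
    intro m n hmn
    exact (Set.disjoint_sdiff_left).mono_right (Set.sdiff_subset.trans (hanti hmn))

namespace MeasureTheory.Lp

/-! ### The infinite-dimensional subspace. -/

variable {Ω : Type*} [MeasurableSpace Ω] {μ : Measure Ω} {p : ℝ≥0∞} [Fact (1 ≤ p)]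

/-- Restrictions of `g` to disjoint non-null subsets of its support are independent: multiplying a
relation by one indicator isolates one coefficient. -/
theorem not_finiteDimensional_of_indicatorCLM_mem (hμ : HasNoAtoms μ) {g : Lp ℝ p μ}
    (hg : g ≠ 0) {E : Submodule ℝ (Lp ℝ p μ)}
    (hE : ∀ (s : Set Ω) (hs : MeasurableSet s), indicatorCLM s hs g ∈ E) :
    ¬ FiniteDimensional ℝ E := by
  intro hfin
  have hA0 : μ {x | g x ≠ 0} ≠ 0 := by
    intro h0
    exact hg ((Lp.eq_zero_iff_ae_eq_zero).2 (ae_iff.2 h0))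
  obtain ⟨C, hC, hCA, hC0, hCd⟩ := hμ.exists_disjoint_seq (measurableSet_support g) hA0
  have hne : ∀ n, indicatorCLM (C n) (hC n) g ≠ 0 := by
    intro n h0
    rw [indicatorCLM_eq_zero_iff] at h0
    refine hC0 n (measure_mono_null (fun x hx => ?_) (ae_iff.1 h0))
    exact fun h => hCA n hx (h hx)
  have hproj : ∀ m n, m ≠ n →
      indicatorCLM (C m) (hC m) (indicatorCLM (C n) (hC n) g) = 0 := by
    intro m n hmn
    rw [indicatorCLM_eq_zero_iff]
    filter_upwards [coeFn_indicatorCLM (C n) (hC n) g] with x hx hxm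
    rw [hx, Set.indicator_of_notMem (Set.disjoint_left.1 (hCd hmn) hxm)]
  have hself : ∀ n, indicatorCLM (C n) (hC n) (indicatorCLM (C n) (hC n) g) =
      indicatorCLM (C n) (hC n) g := by
    intro n
    rw [indicatorCLM_eq_self_iff]
    filter_upwards [coeFn_indicatorCLM (C n) (hC n) g] with x hx hxn
    rw [hx, Set.indicator_of_notMem hxn]
  have hli : LinearIndependent ℝ
      fun n => (⟨indicatorCLM (C n) (hC n) g, hE _ _⟩ : E) := by
    refine LinearIndependent.of_comp E.subtype ?_
    rw [linearIndependent_iff']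
    intro t c hsum i hi
    have := congrArg (indicatorCLM (C i) (hC i)) hsum
    rw [map_sum, map_zero, Finset.sum_eq_single_of_mem i hi] at this
    · simp only [Function.comp_apply, Submodule.subtype_apply, map_smul, hself] at this
      exact (smul_eq_zero.1 this).resolve_right (hne i)
    · intro j _ hj
      simp only [Function.comp_apply, Submodule.subtype_apply, map_smul, hproj i j hj.symm,
        smul_zero]
  have := hli.finite
  exact not_finite ℕ

theorem exists_isIsomorphismOn_sub_id (hp_top : p ≠ ∞) (hp_two : p ≠ 2) (hμ : HasNoAtoms μ)
    (T : Lp ℝ p μ →ₗᵢ[ℝ] Lp ℝ p μ) (hT : T ≠ LinearIsometry.id) :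
    ∃ E : Submodule ℝ (Lp ℝ p μ), IsClosed (E : Set (Lp ℝ p μ)) ∧ ¬ FiniteDimensional ℝ E ∧
      IsIsomorphismOn (T.toContinuousLinearMap - ContinuousLinearMap.id ℝ (Lp ℝ p μ)) E := by
  rcases exists_disjoint_map_or_exists_map_eq_neg hp_top hp_two T hT with
    ⟨g, hg, hdisj⟩ | ⟨h, hh, hneg⟩
  · have hA := measurableSet_support g
    let P : Lp ℝ p μ →L[ℝ] Lp ℝ p μ := indicatorCLM _ hA
    let R : Lp ℝ p μ →L[ℝ] Lp ℝ p μ := P - ContinuousLinearMap.id ℝ _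
    let Q : Lp ℝ p μ →L[ℝ] Lp ℝ p μ := P.comp T.toContinuousLinearMap
    -- The subspace consists of the `f` supported where `g ≠ 0` whose image vanishes there, so `P (T
    -- f - f) = -f` bounds `T - I` below.
    refine ⟨R.ker ⊓ Q.ker, R.isClosed_ker.inter Q.isClosed_ker,
      not_finiteDimensional_of_indicatorCLM_mem hμ hg fun s hs => ⟨?_, ?_⟩,
      IsIsomorphismOn.of_norm_le ?_⟩
    · refine sub_eq_zero.2 (indicatorCLM_eq_self_iff.2 ?_)
      filter_upwards [coeFn_indicatorCLM s hs g] with x hx h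
      have : g x = 0 := by simpa using h
      rw [hx, Set.indicator_apply_eq_zero]
      exact fun _ => this
    · refine indicatorCLM_eq_zero_iff (hs := hA) (f := T (indicatorCLM s hs g)).2 ?_
      -- The two images are disjoint and sum to `T g`, which vanishes on the support of `g`; hence
      -- each of them vanishes there.
      have hd : AEDisjointSupport (T (indicatorCLM s hs g)) (T (indicatorCLM sᶜ hs.compl g)) :=
        (aeDisjointSupport_indicatorCLM hs hs.compl disjoint_compl_right g g).map hp_top hp_two T
      have hadd : T g = T (indicatorCLM s hs g) + T (indicatorCLM sᶜ hs.compl g) := by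
        rw [← map_add, indicatorCLM_add_compl]
      filter_upwards [hd, hdisj, Lp.coeFn_add (T (indicatorCLM s hs g))
        (T (indicatorCLM sᶜ hs.compl g))] with x h1 h2 h3 hx
      rw [← hadd, Pi.add_apply, h2.resolve_left hx] at h3
      rcases h1 with h1 | h1
      · exact h1
      · rw [h1, add_zero] at h3
        exact h3.symm
    · rintro f ⟨h1, h2⟩
      have h1 : P f = f := sub_eq_zero.1 h1
      have h2 : P (T f) = 0 := h2
      calc ‖f‖ = ‖P (T f - f)‖ := by rw [map_sub, h1, h2, zero_sub, norm_neg]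
        _ ≤ ‖T f - f‖ := norm_indicatorCLM_le _ hA _
  -- The `-1` eigenspace of `T` works, since `T - I` is `-2` on it.
  · let R : Lp ℝ p μ →L[ℝ] Lp ℝ p μ := T.toContinuousLinearMap + ContinuousLinearMap.id ℝ _
    refine ⟨R.ker, R.isClosed_ker, not_finiteDimensional_of_indicatorCLM_mem hμ hh
      fun s hs => ?_, IsIsomorphismOn.of_norm_le fun f hf => ?_⟩
    · exact add_eq_zero_iff_eq_neg.2 (hneg s hs)
    · have hf : T f = -f := add_eq_zero_iff_eq_neg.1 hf
      change ‖f‖ ≤ ‖T f - f‖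
      rw [hf, ← neg_add', norm_neg, ← two_smul ℝ f, norm_smul, Real.norm_two]
      linarith [norm_nonneg f]

end MeasureTheory.Lp

theorem mainTheorem9 {Ω : Type*} [MeasurableSpace Ω] (μ : Measure Ω)
    (p : ℝ≥0∞) [Fact (1 ≤ p)] (hp_top : p ≠ ∞) (hp_two : p ≠ 2) :
    (∀ T : Lp ℝ p μ →ₗᵢ[ℝ] Lp ℝ p μ, T ≠ LinearIsometry.id →
      Real.sqrt 2 < ‖T.toContinuousLinearMap - ContinuousLinearMap.id ℝ (Lp ℝ p μ)‖) ∧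
    DiscreteTopology (isoSet (Lp ℝ p μ)) ∧
    (HasNoAtoms μ → ∀ T : Lp ℝ p μ →ₗᵢ[ℝ] Lp ℝ p μ, T ≠ LinearIsometry.id →
      ∃ E : Submodule ℝ (Lp ℝ p μ), IsClosed (E : Set (Lp ℝ p μ)) ∧ ¬ FiniteDimensional ℝ E ∧
        IsIsomorphismOn (T.toContinuousLinearMap - ContinuousLinearMap.id ℝ (Lp ℝ p μ)) E) := by
  refine ⟨fun T hT => Lp.sqrt_two_lt_norm_sub_id hp_top hp_two T hT,
    discreteTopology_isoSet (Real.sqrt_pos.2 two_pos) fun T hT => ?_,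
    fun hμ T hT => Lp.exists_isIsomorphismOn_sub_id hp_top hp_two hμ T hT⟩
  refine (Lp.sqrt_two_lt_norm_sub_id hp_top hp_two T.toLinearIsometry fun h => hT ?_).le
  exact LinearIsometryEquiv.ext fun x => DFunLike.congr_fun h x
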